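/- Let $\mathbb F_q$ be a finite field with $q$ elements, $A=\mathbb F_q[T]$, $k=\mathbb F_q(T)$, and let $k_\infty$ be the completion of $k$ with respect to the absolute value $|f|=q^{\deg_T f}$. For $x\in k_\infty$ put $\|x\|=\min_{a\in A}|x-a|$. For $f\in k_\infty$ and $\varepsilon>0$ let $$\Lambda_\varepsilon(f)=\{\lambda\in A : \|\lambda f\|<\varepsilon\},\qquad \zeta_{f,\varepsilon}(n)=\sum_{\lambda\in\Lambda_\varepsilon(f),\ \lambda\text{ monic}}\lambda^{-n},\qquad \zeta_A(n)=\sum_{a\in A,\ a\text{ monic}}a^{-n}\qquad(n\ge 1),$$ which are convergent sums in $k_\infty$. Put $$g_\varepsilon(f)=(T^q-T)\sum_{0\ne\lambda\in\Lambda_\varepsilon(f)}\lambda^{1-q},$$ $$\Delta_\varepsilon(f)=(T^{q^2}-T)\sum_{0\ne\lambda\in\Lambda_\varepsilon(f)}\lambda^{1-q^2}+(T^q-T)^q\Big(\sum_{0\ne\lambda\in\Lambda_\varepsilon(f)}\lambda^{1-q}\Big)^{q+1},$$ and $j_\varepsilon(f)=g_\varepsilon(f)^{q+1}/\Delta_\varepsilon(f)\in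 k_\infty\cup\{\infty\}$, where the value is $\infty$ if $\Delta_\varepsilon(f)=0$. Let $j^{\rm qt}(f)\subset k_\infty\cup\{\infty\}$ be the set of all limits of convergent sequences $j_{\varepsilon_i}(f)$ with $\varepsilon_i>0$, $\varepsilon_i\to0$, where $k_\infty\cup\{\infty\}$ is the one-point compactification of $k_\infty$. Theorem. Let $f\in k$. Then there is $\varepsilon_0>0$ such that for all $0<\varepsilon<\varepsilon_0$: 1. $\Lambda_\varepsilon(f)=hA$ for some nonzero $h\in A$; 2. $\zeta_{f,\varepsilon}(q-1)\neq0$, $\zeta_A(q-1)\ne0$ and $$\frac{\zeta_{f,\varepsilon}(q^2-1)}{\zeta_{f,\varepsilon}(q-1)^{q+1}}=\frac{\zeta_A(q^2-1)}{\zeta_A(q-1)^{q+1}};$$ 3. $j_\varepsilon(f)=\infty$; more precisely $\Delta_\varepsilon(f)=0$ while $g_\varepsilon(f)\neq0$. In particular $j^{\rm qt}(f)=\{\infty\}$. -/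

import Mathlib

open Filter Topology
open scoped NNReal Polynomial

set_option linter.unusedSectionVars false

namespace QuantumJ

noncomputable section

section

variable (F : Type*) [Field F] [DecidableEq (RatFunc F)]

/-- The local field `k_∞`: the completion of `k = F(T)` at the place at infinity. -/
abbrev KInf : Type _ := RatFunc.CompletionAtInfty F

/-- The inclusion of `k = F(T)` into `k_∞`. -/
def ofRat : RatFunc F →+* KInf F := algebraMap (RatFunc F) (KInf F)

/-- The inclusion of `A = F[T]` into `k_∞`. -/
def ofPoly : F[X] →+* KInf F := (ofRat F).comp (algebraMap F[X] (RatFunc F))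

/-- The element `T` of `k_∞`. -/
def T : KInf F := ofPoly F Polynomial.X

end

section

variable {F : Type*} [Field F] [Fintype F] [DecidableEq (RatFunc F)]

/-- The absolute value of `k_∞`, normalised by `|T| = q`, where `q` is the cardinality of the
constant field: `|x| = q ^ (-v x)`. -/
def absInf (x : KInf F) : ℝ :=
  WithZeroMulInt.toNNReal (e := (Fintype.card F : ℝ≥0))
    (Nat.cast_ne_zero.mpr Fintype.card_ne_zero) (Valued.v x)

/-- The distance `‖x‖` from `x` to the nearest element of `A` (the infimum is a minimum, see
`isLeast_distA`). -/
def distA (x : KInf F) : ℝ := ⨅ a : F[X], absInf (x - ofPoly F a)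

/-- The set `Λ_ε(f)` of `ε`-approximations of `f`. -/
def epsApprox (f : KInf F) (ε : ℝ) : Set F[X] :=
  {l | distA (ofPoly F l * f) < ε}

/-- The sum of `l ^ (-n)` over the non-zero elements `l` of a set `S` of polynomials (for `1 ≤ n`
it converges, see `summable_inv_pow`). -/
def eisenstein (S : Set F[X]) (n : ℕ) : KInf F :=
  ∑' l : {l : F[X] // l ∈ S ∧ l ≠ 0}, (ofPoly F (l : F[X]) ^ n)⁻¹

/-- The sum of `l ^ (-n)` over the monic elements `l` of a set `S` of polynomials. -/
def monicZeta (S : Set F[X]) (n : ℕ) : KInf F :=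
  ∑' l : {l : F[X] // l ∈ S ∧ l.Monic}, (ofPoly F (l : F[X]) ^ n)⁻¹

/-- The `ε`-zeta function `ζ_{f,ε}` of `f`. -/
def epsZeta (f : KInf F) (ε : ℝ) (n : ℕ) : KInf F := monicZeta (epsApprox f ε) n

variable (F) in
/-- The zeta function `ζ_A` of `A`. -/
def zetaA (n : ℕ) : KInf F := monicZeta (Set.univ : Set F[X]) n

/-- `Δ_ε(f)`. -/
def DeltaEps (f : KInf F) (ε : ℝ) : KInf F :=
  let q := Fintype.card F
  (T F ^ q ^ 2 - T F) * eisenstein (epsApprox f ε) (q ^ 2 - 1)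
    + (T F ^ q - T F) ^ q * eisenstein (epsApprox f ε) (q - 1) ^ (q + 1)

/-- `g_ε(f)`. -/
def gEps (f : KInf F) (ε : ℝ) : KInf F :=
  let q := Fintype.card F
  (T F ^ q - T F) * eisenstein (epsApprox f ε) (q - 1)

open Classical in
/-- The quotient `x / y` in `k_∞ ∪ {∞}`, equal to `∞` when `y = 0`; meaningful when `x` and `y` are
not both zero. -/
def quot (x y : KInf F) : OnePoint (KInf F) :=
  if y = 0 then OnePoint.infty else ((x / y : KInf F) : OnePoint (KInf F))

/-- The `ε`-modular invariant `j_ε(f) = g_ε(f) ^ (q + 1) / Δ_ε(f)` in `k_∞ ∪ {∞}`. -/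
def jEps (f : KInf F) (ε : ℝ) : OnePoint (KInf F) :=
  quot (gEps f ε ^ (Fintype.card F + 1)) (DeltaEps f ε)

/-- The quantum modular invariant `j^qt(f)`: the set of all limits in `k_∞ ∪ {∞}` of convergent
sequences `j_{ε_i}(f)`, where `ε_i > 0` and `ε_i → 0`. The topology of `k_∞ ∪ {∞}` is that of the
one-point compactification of the locally compact field `k_∞`. -/
def jqt (f : KInf F) : Set (OnePoint (KInf F)) :=
  {x | ∃ ε : ℕ → ℝ, (∀ i, 0 < ε i) ∧ Tendsto ε atTop (𝓝 0) ∧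
    Tendsto (fun i => jEps f (ε i)) atTop (𝓝 x)}

/-! ### The minimum and the sums above exist -/

theorem valued_ofPoly {a : F[X]} (ha : a ≠ 0) :
    Valued.v (ofPoly F a) = WithZero.exp (a.natDegree : ℤ) := by
  have h : ofPoly F a = ofRat F (algebraMap F[X] (RatFunc F) a) := rfl
  rw [h, ← RatFunc.inftyValuation.polynomial F ha]
  exact (RatFunc.inftyValued F).extensionValuation_apply_coe _

theorem absInf_ofPoly {a : F[X]} (ha : a ≠ 0) :
    absInf (ofPoly F a) = (Fintype.card F : ℝ) ^ a.natDegree := by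
  rw [absInf, valued_ofPoly ha, WithZeroMulInt.toNNReal_neg_apply _ WithZero.exp_ne_zero]
  simp [WithZero.exp]

theorem isLeast_distA (x : KInf F) :
    IsLeast (Set.range fun a : F[X] => absInf (x - ofPoly F a)) (distA x) := by
  have key : ∃ a : F[X], ∀ b : F[X],
      Valued.v (x - ofPoly F a) ≤ Valued.v (x - ofPoly F b) := by
    by_cases h : ∃ a : F[X], Valued.v (x - ofPoly F a) < 1
    · obtain ⟨a, ha⟩ := h
      refine ⟨a, fun b => ?_⟩
      by_cases hab : a - b = 0
      · rw [sub_eq_zero.mp hab]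
      · have h1 : (1 : WithZero (Multiplicative ℤ)) ≤ Valued.v (ofPoly F (a - b)) := by
          rw [valued_ofPoly hab, ← WithZero.exp_zero, WithZero.exp_le_exp]
          positivity
        have h2 : x - ofPoly F b = (x - ofPoly F a) + ofPoly F (a - b) := by
          rw [map_sub]; ring
        rw [h2, Valuation.map_add_eq_of_lt_right _ (ha.trans_le h1)]
        exact (ha.trans_le h1).le
    · push Not at h
      let w : F[X] → ℕ := fun a => (WithZero.log (Valued.v (x - ofPoly F a))).toNat
      obtain ⟨a, ha⟩ : ∃ a, ∀ b, w a ≤ w b := ⟨_, fun b => Function.argmin_le w b⟩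
      refine ⟨a, fun b => ?_⟩
      have hpos : ∀ c : F[X], Valued.v (x - ofPoly F c) ≠ 0 := fun c hc => by
        have := h c
        rw [hc] at this
        exact absurd this (by simp)
      have hlog : ∀ c : F[X], 0 ≤ WithZero.log (Valued.v (x - ofPoly F c)) := fun c => by
        rw [← WithZero.log_one]
        exact (WithZero.log_le_log one_ne_zero (hpos c)).mpr (h c)
      rw [← WithZero.log_le_log (hpos a) (hpos b)]
      have : (WithZero.log (Valued.v (x - ofPoly F a))).toNat ≤
        (WithZero.log (Valued.v (x - ofPoly F b))).toNat := ha b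
      have := hlog a
      have := hlog b
      omega
  obtain ⟨a, ha⟩ := key
  have hmin : IsLeast (Set.range fun a : F[X] => absInf (x - ofPoly F a))
      (absInf (x - ofPoly F a)) := by
    refine ⟨⟨a, rfl⟩, ?_⟩
    rintro _ ⟨b, rfl⟩
    have hq : (1 : ℝ≥0) < (Fintype.card F : ℝ≥0) := by
      exact_mod_cast Fintype.one_lt_card
    exact NNReal.coe_le_coe.mpr ((WithZeroMulInt.toNNReal_strictMono hq).monotone (ha b))
  have : distA x = absInf (x - ofPoly F a) := hmin.csInf_eq
  rwa [this]

theorem finite_natDegree_lt (N : ℕ) : {p : F[X] | p.natDegree < N}.Finite := by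
  have : Finite (Polynomial.degreeLT F N) :=
    Finite.of_equiv _ (Polynomial.degreeLTEquiv F N).symm.toEquiv
  refine (Set.toFinite (Polynomial.degreeLT F N : Set F[X])).subset fun p hp => ?_
  rcases eq_or_ne p 0 with rfl | h0
  · exact zero_mem _
  · exact Polynomial.mem_degreeLT.mpr ((Polynomial.natDegree_lt_iff_degree_lt h0).mp hp)

theorem summable_inv_pow (P : F[X] → Prop) (hP : ∀ l, P l → l ≠ 0) {n : ℕ} (hn : 1 ≤ n) :
    Summable fun l : {l : F[X] // P l} => (ofPoly F (l : F[X]) ^ n)⁻¹ := by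
  have : CompleteSpace (KInf F) := by
    let _ := RatFunc.inftyValued F
    exact inferInstanceAs (CompleteSpace (UniformSpace.Completion (RatFunc F)))
  have : NonarchimedeanAddGroup (KInf F) :=
    { is_nonarchimedean := fun U hU => by
        obtain ⟨γ, hγ⟩ := Valued.mem_nhds_zero.mp hU
        let V : AddSubgroup (KInf F) := Valuation.ltAddSubgroup (Valued.v.restrict) γ
        have hV : (V : Set (KInf F)) ∈ 𝓝 (0 : KInf F) :=
          Valued.mem_nhds_zero.mpr ⟨γ, fun y hy => hy⟩
        exact ⟨⟨V, AddSubgroup.isOpen_of_mem_nhds V hV⟩, hγ⟩ }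
  apply NonarchimedeanAddGroup.summable_of_tendsto_cofinite_zero
  intro U hU
  obtain ⟨γ, hγ⟩ := Valued.mem_nhds_zero.mp hU
  obtain ⟨m, hm⟩ : ∃ m : ℤ, MonoidWithZeroHom.ValueGroup₀.embedding γ.1 = WithZero.exp m := by
    refine ⟨WithZero.log (MonoidWithZeroHom.ValueGroup₀.embedding γ.1), ?_⟩
    rw [WithZero.exp_log]
    simp
  have hfin := (finite_natDegree_lt (F := F) (m.natAbs + 1)).preimage
    (Subtype.val_injective (p := P)).injOn
  refine hfin.subset fun l hl => ?_
  by_contra hdeg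
  refine hl (hγ ?_)
  have hdeg' : m.natAbs + 1 ≤ (l : F[X]).natDegree := by
    simpa using hdeg
  change Valued.v.restrict _ < γ.1
  rw [Valuation.restrict_lt_iff_lt_embedding, hm, map_inv₀, map_pow, valued_ofPoly (hP _ l.2),
    ← WithZero.exp_nsmul, ← WithZero.exp_neg, WithZero.exp_lt_exp, nsmul_eq_mul]
  have h1 : ((l : F[X]).natDegree : ℤ) ≤ (n : ℤ) * ((l : F[X]).natDegree : ℤ) :=
    le_mul_of_one_le_left (by positivity) (by exact_mod_cast hn)
  omega

end

end

end QuantumJ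

namespace QuantumJ

/-! ### The `q`-power Frobenius on `F_q`-algebras -/

section FiniteLevel

open Polynomial

variable {F K : Type*} [Field F] [Fintype F] [Field K]

/-! Write `f = N / D` in lowest terms with `D` monic. If `‖λ f‖ < 1 / |D|`, some `λ N - a D` is a
polynomial of absolute value less than `1`, hence zero, so `D ∣ λ`; thus `Λ_ε(f) = D A` for small
`ε` (`epsApprox_ofRat`). All sums are homogeneous, so everything reduces to the lattice `A`: powers
of `D` cancel from the zeta quotient and factor out of `Δ_ε` and `g_ε`.

For `A`, the vanishing of `Δ` says that the Carlitz module has rank one. It is proved with finite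
products only. Let `e_d` be the monic polynomial whose roots are the polynomials of degree `< d`. It
is `F_q`-linear, and splitting `a' = T a + c` gives `e_{d+1}(T X) = M (e_d ^ q - w e_d)`
(`vanishingPoly_succ_comp`). Normalise `e_d` to `X + α_d X ^ q + β_d X ^ (q ^ 2) + ⋯`. Eliminating
`M` and `w` gives `β_{d+1} T ^ (q ^ 2 - 1) - β_d = (α_{d+1} T ^ (q - 1) - α_d) α_d ^ q`, while
Newton's identities express `α_d` and `β_d` through the inverse power sums `S_d(q - 1)` and `S_d(q ^
2 - 1)`. The limit `d → ∞` is the relation `Δ = 0` (`carlitz_relation_of_tendsto`).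

Nonvanishing is ultrametric: the constants contribute a term of absolute value `1` and every other
term is smaller. -/

theorem exists_charP_and_card_eq (φ : F →+* K) :
    ∃ p n : ℕ, p.Prime ∧ CharP K p ∧ Fintype.card F = p ^ n := by
  obtain ⟨p, hp⟩ := CharP.exists F
  obtain ⟨n, hpp, hn⟩ := FiniteField.card F p
  exact ⟨p, n, hpp, charP_of_injective_ringHom φ.injective p, hn⟩

theorem cast_card_eq_zero_of_hom (φ : F →+* K) : (Fintype.card F : K) = 0 := by
  rw [← map_natCast φ, FiniteField.cast_card_eq_zero, map_zero]

theorem add_pow_card_of_hom (φ : F →+* K) (x y : K[X]) :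
    (x + y) ^ Fintype.card F = x ^ Fintype.card F + y ^ Fintype.card F := by
  obtain ⟨p, n, hp, _, hq⟩ := exists_charP_and_card_eq φ
  have : Fact p.Prime := ⟨hp⟩
  rw [hq, add_pow_char_pow]

theorem sub_pow_card_pow_of_hom (φ : F →+* K) (x y : K[X]) (i : ℕ) :
    (x - y) ^ Fintype.card F ^ i = x ^ Fintype.card F ^ i - y ^ Fintype.card F ^ i := by
  obtain ⟨p, n, hp, _, hq⟩ := exists_charP_and_card_eq φ
  have : Fact p.Prime := ⟨hp⟩
  rw [hq, ← pow_mul, sub_pow_char_pow]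

theorem sub_pow_card_of_hom (φ : F →+* K) (x y : K) :
    (x - y) ^ Fintype.card F = x ^ Fintype.card F - y ^ Fintype.card F := by
  obtain ⟨p, n, hp, _, hq⟩ := exists_charP_and_card_eq φ
  have : Fact p.Prime := ⟨hp⟩
  rw [hq, sub_pow_char_pow]

theorem sum_pow_card_of_hom (φ : F →+* K) {ι : Type*} (s : Finset ι) (f : ι → K) :
    ∑ i ∈ s, f i ^ Fintype.card F = (∑ i ∈ s, f i) ^ Fintype.card F := by
  obtain ⟨p, n, hp, _, hq⟩ := exists_charP_and_card_eq φ
  have : Fact p.Prime := ⟨hp⟩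
  rw [hq, sum_pow_char_pow]

theorem pow_card_eq_map_expand (φ : F →+* K) (P : K[X]) :
    ∃ σ : K →+* K, (∀ x, σ x = x ^ Fintype.card F) ∧
      P ^ Fintype.card F = (expand K (Fintype.card F) P).map σ := by
  obtain ⟨p, n, hp, _, hq⟩ := exists_charP_and_card_eq φ
  have : Fact p.Prime := ⟨hp⟩
  refine ⟨iterateFrobenius K p n, fun x => ?_, ?_⟩
  · rw [iterateFrobenius_def, hq]
  · rw [hq, map_iterateFrobenius_expand]

theorem coeff_pow_card_mul (φ : F →+* K) (P : K[X]) (n : ℕ) :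
    (P ^ Fintype.card F).coeff (n * Fintype.card F) = P.coeff n ^ Fintype.card F := by
  obtain ⟨σ, hσ, h⟩ := pow_card_eq_map_expand φ P
  rw [h, coeff_map, coeff_expand_mul Fintype.card_pos, hσ]

theorem coeff_pow_card_one (φ : F →+* K) (P : K[X]) :
    (P ^ Fintype.card F).coeff 1 = 0 := by
  obtain ⟨σ, hσ, h⟩ := pow_card_eq_map_expand φ P
  have h1 : ¬ Fintype.card F ∣ 1 := by
    have := Fintype.one_lt_card (α := F)
    rw [Nat.dvd_one]; omega
  rw [h, coeff_map, coeff_expand Fintype.card_pos, if_neg h1, map_zero]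

/-! ### `F_q`-linear polynomials -/

/-- The `K`-module of additive polynomials in the powers `X ^ (q ^ i)`. -/
noncomputable def additivePolynomials (K : Type*) [Field K] (q : ℕ) : Submodule K K[X] :=
  Submodule.span K (Set.range fun i : ℕ => (X : K[X]) ^ q ^ i)

theorem additivePolynomials.pow_mem (φ : F →+* K) {P : K[X]}
    (hP : P ∈ additivePolynomials K (Fintype.card F)) :
    P ^ Fintype.card F ∈ additivePolynomials K (Fintype.card F) := by
  induction hP using Submodule.span_induction with
  | mem x hx =>
    obtain ⟨i, rfl⟩ := hx
    refine Submodule.subset_span ⟨i + 1, ?_⟩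
    simp only [pow_succ, pow_mul]
  | zero => rw [zero_pow Fintype.card_ne_zero]; exact zero_mem _
  | add x y _ _ hx hy => rw [add_pow_card_of_hom φ]; exact add_mem hx hy
  | smul a x _ hx => rw [_root_.smul_pow]; exact Submodule.smul_mem _ _ hx

theorem additivePolynomials.comp_C_mul_X_mem {q : ℕ} {P : K[X]}
    (hP : P ∈ additivePolynomials K q) (t : K) :
    P.comp (C t * X) ∈ additivePolynomials K q := by
  induction hP using Submodule.span_induction with
  | mem x hx =>
    obtain ⟨i, rfl⟩ := hx
    simp only [pow_comp, X_comp, mul_pow, ← C_pow]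
    rw [← smul_eq_C_mul]
    exact Submodule.smul_mem _ _ (Submodule.subset_span ⟨i, rfl⟩)
  | zero => simp
  | add x y _ _ hx hy => rw [add_comp]; exact add_mem hx hy
  | smul a x _ hx => rw [smul_comp]; exact Submodule.smul_mem _ _ hx

theorem additivePolynomials.coeff_eq_zero {q : ℕ} {P : K[X]}
    (hP : P ∈ additivePolynomials K q) {n : ℕ} (hn : ∀ i, n ≠ q ^ i) : P.coeff n = 0 := by
  induction hP using Submodule.span_induction with
  | mem x hx =>
    obtain ⟨i, rfl⟩ := hx
    simp only [coeff_X_pow, if_neg (hn i)]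
  | zero => simp
  | add x y _ _ hx hy => rw [coeff_add, hx, hy, add_zero]
  | smul a x _ hx => rw [coeff_smul, hx, smul_zero]

theorem additivePolynomials.derivative_eq (φ : F →+* K) {P : K[X]}
    (hP : P ∈ additivePolynomials K (Fintype.card F)) :
    derivative P = C (P.coeff 1) := by
  induction hP using Submodule.span_induction with
  | mem x hx =>
    obtain ⟨i, rfl⟩ := hx
    rcases i with _ | i
    · simp
    · have h1 : (1 : ℕ) ≠ Fintype.card F ^ (i + 1) :=
        (Nat.one_lt_pow (Nat.succ_ne_zero i) Fintype.one_lt_card).ne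
      simp only [derivative_X_pow, coeff_X_pow, if_neg h1, Nat.cast_pow,
        cast_card_eq_zero_of_hom φ]
      simp
  | zero => simp
  | add x y _ _ hx hy => rw [derivative_add, hx, hy, coeff_add, C_add]
  | smul a x _ hx => rw [derivative_smul, hx, coeff_smul, smul_C]

theorem pow_card_pow_of_hom (φ : F →+* K) (c : F) (i : ℕ) :
    φ c ^ Fintype.card F ^ i = φ c := by
  rw [← map_pow, FiniteField.pow_card_pow]

/-- Each `X ^ (q ^ i)` is additive in characteristic `p` and commutes with scalars from `F_q`, since
`c ^ (q ^ i) = c`. -/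
theorem additivePolynomials.comp_X_sub_C (φ : F →+* K) {P : K[X]}
    (hP : P ∈ additivePolynomials K (Fintype.card F)) (c : F) (w : K) :
    P.comp (X - C (φ c * w)) = P - C (φ c * P.eval w) := by
  induction hP using Submodule.span_induction with
  | mem x hx =>
    obtain ⟨i, rfl⟩ := hx
    simp only [pow_comp, X_comp, eval_pow, eval_X]
    rw [sub_pow_card_pow_of_hom φ, ← C_pow, mul_pow, pow_card_pow_of_hom]
  | zero => simp
  | add x y _ _ hx hy => rw [add_comp, hx, hy, eval_add, mul_add, C_add]; ring
  | smul a x _ hx =>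
    rw [smul_comp, hx, eval_smul, smul_sub, smul_C, smul_eq_mul, smul_eq_mul, mul_left_comm]

theorem prod_X_sub_C_eq_X_pow_card_sub_X :
    ∏ c : F, (X - C c) = (X ^ Fintype.card F - X : F[X]) := by
  have hq := Fintype.one_lt_card (α := F)
  have h := prod_multiset_X_sub_C_of_monic_of_roots_card_eq
    (p := (X ^ Fintype.card F - X : F[X])) (monic_X_pow_sub (by simpa using hq)) (by
      rw [FiniteField.roots_X_pow_card_sub_X, FiniteField.X_pow_card_sub_X_natDegree_eq F hq]
      rfl)
  rw [FiniteField.roots_X_pow_card_sub_X] at h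
  exact h

/-- The homogeneous form of `∏ (X - c) = X ^ q - X`: substitute `P / w` for `X` and multiply by `w ^
q`. The case `w = 0` is separate. -/
theorem prod_sub_C_mul (φ : F →+* K) (P : K[X]) (w : K) :
    ∏ c : F, (P - C (φ c * w)) =
      P ^ Fintype.card F - C (w ^ (Fintype.card F - 1)) * P := by
  have hq := Fintype.one_lt_card (α := F)
  rcases eq_or_ne w 0 with rfl | hw
  · have : Fintype.card F - 1 ≠ 0 := by omega
    simp [this]
  have h := congrArg (eval₂ (C.comp φ) (C w⁻¹ * P)) (prod_X_sub_C_eq_X_pow_card_sub_X (F := F))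
  rw [eval₂_finsetProd] at h
  simp only [eval₂_sub, eval₂_X, eval₂_C, eval₂_X_pow, RingHom.comp_apply] at h
  have hww : (C w * C w⁻¹ : K[X]) = 1 := by rw [← C_mul, mul_inv_cancel₀ hw, C_1]
  have h2 : ∀ c : F, P - C (φ c * w) = C w * (C w⁻¹ * P - C (φ c)) := fun c => by
    rw [mul_sub, ← mul_assoc, hww, one_mul, C_mul, mul_comm (C w)]
  rw [Finset.prod_congr rfl fun c _ => h2 c, Finset.prod_mul_distrib, h, Finset.prod_const,
    Finset.card_univ, mul_sub, ← mul_pow, ← mul_assoc, hww, one_mul]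
  obtain ⟨m, hm⟩ : ∃ m, Fintype.card F = m + 1 := ⟨_, (Nat.succ_pred Fintype.card_ne_zero).symm⟩
  rw [hm, Nat.add_sub_cancel, pow_succ (C w), mul_assoc, ← mul_assoc (C w), hww, one_mul, C_pow]

/-! ### Polynomials of bounded degree and their vanishing polynomials -/

open Classical in
variable (F) in
/-- The finite set of polynomials of degree less than `d`. -/
noncomputable def polysLT : ℕ → Finset F[X]
  | 0 => {0}
  | d + 1 => (polysLT d ×ˢ Finset.univ).image fun x : F[X] × F => X * x.1 + C x.2

theorem mem_polysLT {d : ℕ} {p : F[X]} : p ∈ polysLT F d ↔ p.degree < d := by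
  induction d generalizing p with
  | zero => simp [polysLT]
  | succ d ih =>
    simp only [polysLT, Finset.mem_image, Finset.mem_product, Finset.mem_univ, and_true,
      Prod.exists]
    constructor
    · rintro ⟨a, c, ha, rfl⟩
      rw [ih, degree_lt_iff_coeff_zero] at ha
      rw [degree_lt_iff_coeff_zero]
      intro m hm
      obtain ⟨m, rfl⟩ : ∃ k, m = k + 1 := ⟨m - 1, by omega⟩
      rw [coeff_add, coeff_X_mul, ha m (by omega), coeff_C_succ, add_zero]
    · intro hp
      refine ⟨p.divX, p.coeff 0, ?_, by rw [mul_comm]; exact divX_mul_X_add p⟩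
      rw [ih, degree_lt_iff_coeff_zero]
      rw [degree_lt_iff_coeff_zero] at hp
      intro m hm
      rw [coeff_divX]
      exact hp _ (by omega)

open Classical in
variable (F) in
/-- The finite set of non-zero polynomials of degree less than `d`. -/
noncomputable def nonzeroPolysLT (d : ℕ) : Finset F[X] := (polysLT F d).filter (· ≠ 0)

theorem mem_nonzeroPolysLT {d : ℕ} {p : F[X]} :
    p ∈ nonzeroPolysLT F d ↔ p.degree < d ∧ p ≠ 0 := by
  classical
  rw [nonzeroPolysLT, Finset.mem_filter, mem_polysLT]

theorem zero_mem_polysLT (d : ℕ) : (0 : F[X]) ∈ polysLT F d := by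
  rw [mem_polysLT]; simp

theorem prod_polysLT_succ {M : Type*} [CommMonoid M] (d : ℕ) (f : F[X] → M) :
    ∏ p ∈ polysLT F (d + 1), f p = ∏ c : F, ∏ a ∈ polysLT F d, f (X * a + C c) := by
  classical
  rw [polysLT, Finset.prod_image, Finset.prod_product_right]
  rintro ⟨a, c⟩ - ⟨b, e⟩ - h
  have h0 : c = e := by simpa using congrArg (fun p => coeff p 0) h
  subst h0
  have h1 : X * a = X * b := add_right_cancel h
  rw [mul_left_cancel₀ X_ne_zero h1]

/-- The monic polynomial with the polynomials of degree less than `d` as its roots. -/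
noncomputable def vanishingPoly (φ : F[X] →+* K) (d : ℕ) : K[X] :=
  ∏ a ∈ polysLT F d, (X - C (φ a))

/-- Taking `T` out of each factor `T X - (T a + c)` leaves `X - c / T - a`, so the product over `a`
is `e_d(X - c / T) = e_d(X) - c e_d(1 / T)` by linearity. The product over `c` is then
`prod_sub_C_mul` with `w = e_d(1 / T)`. -/
theorem vanishingPoly_succ_comp {φ : F[X] →+* K} (hφ : Function.Injective φ) {d : ℕ}
    (hd : vanishingPoly φ d ∈ additivePolynomials K (Fintype.card F)) :
    ∃ M w : K, M ≠ 0 ∧ (vanishingPoly φ (d + 1)).comp (C (φ X) * X) =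
      C M * (vanishingPoly φ d ^ Fintype.card F - C w * vanishingPoly φ d) := by
  have ht : φ X ≠ 0 := (map_ne_zero_iff φ hφ).mpr X_ne_zero
  refine ⟨∏ c : F, ∏ a ∈ polysLT F d, φ X,
    (vanishingPoly φ d).eval (φ X)⁻¹ ^ (Fintype.card F - 1),
    by simp [Finset.prod_const, ht], ?_⟩
  rw [← prod_sub_C_mul (φ.comp C) _ ((vanishingPoly φ d).eval (φ X)⁻¹)]
  simp_rw [← additivePolynomials.comp_X_sub_C (φ.comp C) hd]
  rw [vanishingPoly, prod_polysLT_succ, map_prod, prod_comp, ← Finset.prod_mul_distrib]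
  refine Finset.prod_congr rfl fun c _ => ?_
  rw [vanishingPoly, prod_comp, prod_comp, map_prod, ← Finset.prod_mul_distrib]
  refine Finset.prod_congr rfl fun a _ => ?_
  simp only [sub_comp, add_comp, mul_comp, X_comp, C_comp, map_add, map_mul, RingHom.comp_apply]
  have hww : (C (φ X) * C (φ X)⁻¹ : K[X]) = 1 := by rw [← C_mul, mul_inv_cancel₀ ht, C_1]
  linear_combination (C (φ (C c))) * hww

theorem vanishingPoly_mem {φ : F[X] →+* K} (hφ : Function.Injective φ) (d : ℕ) :
    vanishingPoly φ d ∈ additivePolynomials K (Fintype.card F) := by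
  induction d with
  | zero =>
    refine Submodule.subset_span ⟨0, ?_⟩
    simp [vanishingPoly, polysLT]
  | succ d ih =>
    obtain ⟨M, w, -, h⟩ := vanishingPoly_succ_comp hφ ih
    have ht : φ X ≠ 0 := (map_ne_zero_iff φ hφ).mpr X_ne_zero
    -- Undo the substitution `X ↦ T X`, which preserves `F_q`-linearity in both directions.
    have h2 : vanishingPoly φ (d + 1) =
        ((vanishingPoly φ (d + 1)).comp (C (φ X) * X)).comp (C (φ X)⁻¹ * X) := by
      rw [comp_assoc]
      simp [← mul_assoc, ← C_mul, ht]
    rw [h2, h, ← smul_eq_C_mul, ← smul_eq_C_mul]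
    exact additivePolynomials.comp_C_mul_X_mem (Submodule.smul_mem _ _ (sub_mem
      (additivePolynomials.pow_mem (φ.comp C) ih) (Submodule.smul_mem _ _ ih))) _

/-- The polynomial with constant term `1` and the non-zero polynomials of degree less than `d` as
its roots. -/
noncomputable def unitVanishingPoly (φ : F[X] →+* K) (d : ℕ) : K[X] :=
  ∏ a ∈ nonzeroPolysLT F d, (1 - C (φ a)⁻¹ * X)

theorem vanishingPoly_eq {φ : F[X] →+* K} (hφ : Function.Injective φ) (d : ℕ) :
    ∃ m : K, m ≠ 0 ∧ vanishingPoly φ d = C m * (X * unitVanishingPoly φ d) := by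
  classical
  refine ⟨∏ a ∈ nonzeroPolysLT F d, -φ a, ?_, ?_⟩
  · rw [Finset.prod_ne_zero_iff]
    intro a ha
    rw [neg_ne_zero, map_ne_zero_iff φ hφ]
    exact (mem_nonzeroPolysLT.mp ha).2
  · rw [vanishingPoly, ← Finset.mul_prod_erase _ _ (zero_mem_polysLT d), map_zero, C_0, sub_zero,
      mul_left_comm, unitVanishingPoly, map_prod, ← Finset.prod_mul_distrib,
      ← Finset.filter_ne', nonzeroPolysLT]
    congr 1
    refine Finset.prod_congr rfl fun a ha => ?_
    have ha : φ a ≠ 0 := (map_ne_zero_iff φ hφ).mpr (mem_nonzeroPolysLT.mp ha).2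
    have hww : (C (φ a) * C (φ a)⁻¹ : K[X]) = 1 := by rw [← C_mul, mul_inv_cancel₀ ha, C_1]
    rw [C_neg]
    linear_combination (- X) * hww

theorem unitVanishingPoly_coeff_zero (φ : F[X] →+* K) (d : ℕ) :
    (unitVanishingPoly φ d).coeff 0 = 1 := by
  rw [coeff_zero_eq_eval_zero, unitVanishingPoly, eval_prod]
  simp

theorem X_mul_unitVanishingPoly_mem {φ : F[X] →+* K} (hφ : Function.Injective φ) (d : ℕ) :
    X * unitVanishingPoly φ d ∈ additivePolynomials K (Fintype.card F) := by
  obtain ⟨m, hm, h⟩ := vanishingPoly_eq hφ d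
  have h2 : X * unitVanishingPoly φ d = m⁻¹ • vanishingPoly φ d := by
    rw [h, smul_eq_C_mul, ← mul_assoc, ← C_mul, inv_mul_cancel₀ hm, C_1, one_mul]
  rw [h2]
  exact Submodule.smul_mem _ _ (vanishingPoly_mem hφ d)

/-! ### Inverse power sums and Newton's identities -/

/-- The sum of `a ^ (-n)` over the non-zero polynomials `a` of degree less than `d`. -/
noncomputable def invPowSum (φ : F[X] →+* K) (d n : ℕ) : K :=
  ∑ a ∈ nonzeroPolysLT F d, (φ a ^ n)⁻¹

theorem invPowSum_mul_card (φ : F[X] →+* K) (d n : ℕ) :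
    invPowSum φ d (n * Fintype.card F) = invPowSum φ d n ^ Fintype.card F := by
  rw [invPowSum, invPowSum, ← sum_pow_card_of_hom (φ.comp C)]
  simp_rw [inv_pow, pow_mul]

/-- Newton's identity: the logarithmic derivative of a product `∏ (1 - b i * X)`. -/
theorem neg_X_mul_derivative_prod {ι : Type*} (s : Finset ι) (b : ι → K) :
    ((-(X * derivative (∏ i ∈ s, (1 - C (b i) * X))) : K[X]) : PowerSeries K) =
      ((∏ i ∈ s, (1 - C (b i) * X) : K[X]) : PowerSeries K) *
        PowerSeries.mk fun n => if n = 0 then 0 else ∑ i ∈ s, b i ^ n := by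
  classical
  have hmk : (PowerSeries.mk fun n => if n = 0 then 0 else ∑ i ∈ s, b i ^ n) =
      ∑ i ∈ s, PowerSeries.mk fun n => if n = 0 then 0 else b i ^ n := by
    ext n
    rw [map_sum]
    simp only [PowerSeries.coeff_mk]
    split_ifs <;> simp
  -- The geometric series `c X / (1 - c X) = ∑ c ^ n X ^ n` over `n ≥ 1`, with the denominator
  -- cleared.
  have hgeom : ∀ c : K, ((C c * X : K[X]) : PowerSeries K) =
      ((1 - C c * X : K[X]) : PowerSeries K) *
      PowerSeries.mk fun n => if n = 0 then 0 else c ^ n := by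
    intro c
    ext n
    rw [coeff_coe, coe_sub, coe_one, coe_mul, coe_C, coe_X, sub_mul, one_mul, map_sub, mul_assoc,
      PowerSeries.coeff_C_mul, coeff_C_mul]
    rcases n with _ | n
    · simp
    · rw [PowerSeries.coeff_succ_X_mul, PowerSeries.coeff_mk, PowerSeries.coeff_mk, coeff_X]
      rcases n with _ | n
      · simp
      · simp [pow_succ']
  rw [hmk, Finset.mul_sum, derivative_prod_finset, Finset.mul_sum, ← Finset.sum_neg_distrib]
  rw [← coeToPowerSeries.ringHom_apply, map_sum]
  refine Finset.sum_congr rfl fun i hi => ?_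
  rw [coeToPowerSeries.ringHom_apply, ← Finset.mul_prod_erase s _ hi, coe_mul, mul_right_comm,
    ← hgeom, ← coe_mul]
  congr 1
  simp only [derivative_sub, derivative_one, derivative_C_mul, derivative_X]
  ring

/-- For `U = unitVanishingPoly φ d`, the polynomial `X U` is `F_q`-linear with linear coefficient
`1`, so its derivative is `1`. Hence `-X U' = U - 1`, and Newton's identity loses its derivative. -/
theorem unitVanishingPoly_newton {φ : F[X] →+* K} (hφ : Function.Injective φ) (d : ℕ) :
    ((unitVanishingPoly φ d - 1 : K[X]) : PowerSeries K) =
      (unitVanishingPoly φ d : PowerSeries K) *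
        PowerSeries.mk fun n => if n = 0 then 0 else invPowSum φ d n := by
  have h1 := additivePolynomials.derivative_eq (φ.comp C) (X_mul_unitVanishingPoly_mem hφ d)
  have h2 := neg_X_mul_derivative_prod (K := K) (nonzeroPolysLT F d) fun a => (φ a)⁻¹
  rw [coeff_X_mul, unitVanishingPoly_coeff_zero, derivative_mul, derivative_X, one_mul, C_1] at h1
  have h3 : unitVanishingPoly φ d - 1 = -(X * derivative (unitVanishingPoly φ d)) := by
    linear_combination h1
  rw [h3]
  simp_rw [inv_pow] at h2
  exact h2

theorem unitVanishingPoly_coeff_eq_zero {φ : F[X] →+* K} (hφ : Function.Injective φ) (d : ℕ)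
    {n : ℕ} (hn : ∀ i, n + 1 ≠ Fintype.card F ^ i) : (unitVanishingPoly φ d).coeff n = 0 := by
  rw [← coeff_X_mul]
  exact additivePolynomials.coeff_eq_zero (X_mul_unitVanishingPoly_mem hφ d) hn

theorem unitVanishingPoly_coeff_card_sub_one {φ : F[X] →+* K} (hφ : Function.Injective φ)
    (d : ℕ) :
    (unitVanishingPoly φ d).coeff (Fintype.card F - 1) = invPowSum φ d (Fintype.card F - 1) := by
  have hq := Fintype.one_lt_card (α := F)
  have h := congrArg (PowerSeries.coeff (Fintype.card F - 1)) (unitVanishingPoly_newton hφ d)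
  rw [coeff_coe, coeff_sub, coeff_one, if_neg (by omega), sub_zero, PowerSeries.coeff_mul,
    Finset.sum_eq_single (0, Fintype.card F - 1)] at h
  · rw [h, coeff_coe, unitVanishingPoly_coeff_zero, one_mul, PowerSeries.coeff_mk,
      if_neg (by omega)]
  · rintro ⟨i, j⟩ hij hne
    rw [Finset.HasAntidiagonal.mem_antidiagonal] at hij
    simp only at hij
    rw [PowerSeries.coeff_mk]
    split_ifs with hj
    · rw [mul_zero]
    rw [coeff_coe, unitVanishingPoly_coeff_eq_zero hφ, zero_mul]
    rintro (_ | k) hk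
    · refine hne ?_
      rw [pow_zero] at hk
      ext <;> simp only <;> omega
    · have : Fintype.card F ≤ Fintype.card F ^ (k + 1) := Nat.le_self_pow (Nat.succ_ne_zero k) _
      omega
  · intro h0
    exact absurd (by simp) h0

/-- Only exponents `q ^ i - 1` occur in the unit polynomial, so the convolution keeps the indices
`0` and `q - 1`; index `q ^ 2 - 1` meets the zero constant term of the power sum series. The second
surviving term involves the power sum of exponent `(q - 1) q`, which is a `q`-th power by Frobenius.
-/
theorem unitVanishingPoly_coeff_card_sq_sub_one {φ : F[X] →+* K} (hφ : Function.Injective φ)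
    (d : ℕ) :
    (unitVanishingPoly φ d).coeff (Fintype.card F ^ 2 - 1) =
      invPowSum φ d (Fintype.card F ^ 2 - 1) +
        invPowSum φ d (Fintype.card F - 1) ^ (Fintype.card F + 1) := by
  have hq := Fintype.one_lt_card (α := F)
  have hlt : Fintype.card F < Fintype.card F ^ 2 := by
    rw [sq]; exact lt_mul_of_one_lt_left (by omega) hq
  have hmul : (Fintype.card F - 1) * Fintype.card F = Fintype.card F ^ 2 - Fintype.card F := by
    rw [Nat.sub_mul, one_mul, sq]
  have hne : ((0, Fintype.card F ^ 2 - 1) : ℕ × ℕ) ≠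
      (Fintype.card F - 1, (Fintype.card F - 1) * Fintype.card F) := fun h => by
    have := congrArg Prod.fst h
    simp only at this
    omega
  have h := congrArg (PowerSeries.coeff (Fintype.card F ^ 2 - 1)) (unitVanishingPoly_newton hφ d)
  rw [coeff_coe, coeff_sub, coeff_one, if_neg (by omega), sub_zero, PowerSeries.coeff_mul,
    ← Finset.sum_subset (s₁ := {(0, Fintype.card F ^ 2 - 1),
      (Fintype.card F - 1, (Fintype.card F - 1) * Fintype.card F)}), Finset.sum_pair hne] at h
  · rw [h, coeff_coe, coeff_coe, unitVanishingPoly_coeff_zero, one_mul, PowerSeries.coeff_mk,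
      if_neg (by omega), PowerSeries.coeff_mk, if_neg (by rw [hmul]; omega), invPowSum_mul_card,
      unitVanishingPoly_coeff_card_sub_one hφ, pow_succ' _ (Fintype.card F)]
  · intro x hx
    rw [Finset.HasAntidiagonal.mem_antidiagonal]
    rcases Finset.mem_insert.mp hx with rfl | hx
    · simp
    · rw [Finset.mem_singleton.mp hx, hmul]
      simp only
      omega
  · rintro ⟨i, j⟩ hij hne
    rw [Finset.HasAntidiagonal.mem_antidiagonal] at hij
    simp only at hij
    rw [PowerSeries.coeff_mk]
    split_ifs with hj
    · rw [mul_zero]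
    rw [coeff_coe, unitVanishingPoly_coeff_eq_zero hφ, zero_mul]
    simp only [Finset.mem_insert, Finset.mem_singleton, Prod.mk.injEq, not_or] at hne
    rintro (_ | _ | k) hk
    · rw [pow_zero] at hk
      omega
    · rw [zero_add, pow_one] at hk
      omega
    · have : Fintype.card F ^ 2 ≤ Fintype.card F ^ (k + 1 + 1) :=
        Nat.pow_le_pow_right (by omega) (by omega)
      omega

/-! ### The recursion in the degree bound and its limit -/

theorem unitVanishingPoly_succ_coeff {φ : F[X] →+* K} (hφ : Function.Injective φ) (d : ℕ) :
    (unitVanishingPoly φ (d + 1)).coeff (Fintype.card F ^ 2 - 1) *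
          φ X ^ (Fintype.card F ^ 2 - 1) -
        (unitVanishingPoly φ d).coeff (Fintype.card F ^ 2 - 1) =
      ((unitVanishingPoly φ (d + 1)).coeff (Fintype.card F - 1) * φ X ^ (Fintype.card F - 1) -
        (unitVanishingPoly φ d).coeff (Fintype.card F - 1)) *
        (unitVanishingPoly φ d).coeff (Fintype.card F - 1) ^ Fintype.card F := by
  have ht : φ X ≠ 0 := (map_ne_zero_iff φ hφ).mpr X_ne_zero
  obtain ⟨M, w, -, h⟩ := vanishingPoly_succ_comp hφ (vanishingPoly_mem hφ d)
  obtain ⟨m, hm, he⟩ := vanishingPoly_eq hφ d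
  obtain ⟨m', hm', he'⟩ := vanishingPoly_eq hφ (d + 1)
  obtain ⟨s, hs⟩ : ∃ s, Fintype.card F = s + 1 :=
    ⟨_, (Nat.succ_pred Fintype.card_ne_zero).symm⟩
  obtain ⟨r, hr⟩ : ∃ r, Fintype.card F ^ 2 = r + 1 :=
    ⟨_, (Nat.succ_pred (pow_ne_zero 2 Fintype.card_ne_zero)).symm⟩
  -- Compare coefficients of `X ^ (n + 1)`; the cases `n + 1 = 1, q, q ^ 2` are used.
  have key : ∀ n, m' * (unitVanishingPoly φ (d + 1)).coeff n * φ X ^ (n + 1) =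
      M * ((vanishingPoly φ d ^ Fintype.card F).coeff (n + 1) -
        w * (m * (unitVanishingPoly φ d).coeff n)) := fun n => by
    have := congrArg (fun p => coeff p (n + 1)) h
    simpa only [comp_C_mul_X_coeff, coeff_C_mul, coeff_sub, he', he, coeff_X_mul] using this
  have k0 := key 0
  have k1 := key s
  have k2 := key r
  have e1 := coeff_pow_card_mul (φ.comp C) (vanishingPoly φ d) 1
  have e2 := coeff_pow_card_mul (φ.comp C) (vanishingPoly φ d) (Fintype.card F)
  rw [one_mul] at e1
  rw [← sq] at e2
  rw [zero_add, coeff_pow_card_one (φ.comp C), unitVanishingPoly_coeff_zero,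
    unitVanishingPoly_coeff_zero] at k0
  rw [← hs, e1, he, coeff_C_mul, coeff_X_mul, unitVanishingPoly_coeff_zero] at k1
  rw [← hr, e2, he, coeff_C_mul] at k2
  have hX : (X * unitVanishingPoly φ d).coeff (Fintype.card F) =
      (unitVanishingPoly φ d).coeff s := by rw [hs, coeff_X_mul]
  rw [hX] at k2
  have hs' : Fintype.card F - 1 = s := by omega
  have hr' : Fintype.card F ^ 2 - 1 = r := by omega
  have ps : φ X ^ Fintype.card F = φ X ^ s * φ X := by rw [hs, pow_succ]
  have pr : φ X ^ Fintype.card F ^ 2 = φ X ^ r * φ X := by rw [hr, pow_succ]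
  rw [hs', hr']
  rw [ps] at k1
  rw [pr, mul_pow] at k2
  apply mul_left_cancel₀ (mul_ne_zero hm' ht)
  -- Subtracting `α_d ^ q` times `k1` from `k2` removes the term `M m ^ q`; then `k0` replaces `-M w
  -- m` by `m' T`.
  linear_combination k2 - (unitVanishingPoly φ d).coeff s ^ Fintype.card F * k1 +
    ((unitVanishingPoly φ d).coeff s * (unitVanishingPoly φ d).coeff s ^ Fintype.card F
      - (unitVanishingPoly φ d).coeff r) * k0

theorem invPowSum_succ {φ : F[X] →+* K} (hφ : Function.Injective φ) (d : ℕ) :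
    (invPowSum φ (d + 1) (Fintype.card F ^ 2 - 1) +
          invPowSum φ (d + 1) (Fintype.card F - 1) ^ (Fintype.card F + 1)) *
          φ X ^ (Fintype.card F ^ 2 - 1) -
        (invPowSum φ d (Fintype.card F ^ 2 - 1) +
          invPowSum φ d (Fintype.card F - 1) ^ (Fintype.card F + 1)) =
      (invPowSum φ (d + 1) (Fintype.card F - 1) * φ X ^ (Fintype.card F - 1) -
        invPowSum φ d (Fintype.card F - 1)) *
        invPowSum φ d (Fintype.card F - 1) ^ Fintype.card F := by
  simp_rw [← unitVanishingPoly_coeff_card_sq_sub_one hφ, ← unitVanishingPoly_coeff_card_sub_one hφ]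
  exact unitVanishingPoly_succ_coeff hφ d

theorem carlitz_relation_of_tendsto [TopologicalSpace K] [IsTopologicalRing K] [T2Space K]
    {φ : F[X] →+* K} (hφ : Function.Injective φ) {a b : K}
    (ha : Filter.Tendsto (fun d => invPowSum φ d (Fintype.card F - 1)) Filter.atTop (nhds a))
    (hb : Filter.Tendsto (fun d => invPowSum φ d (Fintype.card F ^ 2 - 1)) Filter.atTop (nhds b)) :
    (φ X ^ Fintype.card F ^ 2 - φ X) * b +
      (φ X ^ Fintype.card F - φ X) ^ Fintype.card F * a ^ (Fintype.card F + 1) = 0 := by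
  have ha' := ha.comp (Filter.tendsto_add_atTop_nat 1)
  have hb' := hb.comp (Filter.tendsto_add_atTop_nat 1)
  have hl := (((hb'.add (ha'.pow (Fintype.card F + 1))).mul_const
    (φ X ^ (Fintype.card F ^ 2 - 1))).sub (hb.add (ha.pow (Fintype.card F + 1))))
  have hr := ((ha'.mul_const (φ X ^ (Fintype.card F - 1))).sub ha).mul
    (ha.pow (Fintype.card F))
  have h := tendsto_nhds_unique (hl.congr fun d => invPowSum_succ hφ d) hr
  obtain ⟨s, hs⟩ : ∃ s, Fintype.card F = s + 1 :=
    ⟨_, (Nat.succ_pred Fintype.card_ne_zero).symm⟩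
  obtain ⟨r, hr⟩ : ∃ r, Fintype.card F ^ 2 = r + 1 :=
    ⟨_, (Nat.succ_pred (pow_ne_zero 2 Fintype.card_ne_zero)).symm⟩
  have hs' : Fintype.card F - 1 = s := by omega
  have hr' : Fintype.card F ^ 2 - 1 = r := by omega
  have ps : φ X ^ Fintype.card F = φ X ^ s * φ X := by rw [hs, pow_succ]
  have pr : φ X ^ Fintype.card F ^ 2 = φ X ^ r * φ X := by rw [hr, pow_succ]
  rw [hs', hr'] at h
  -- After multiplication by `T`, the limit identity becomes the claim because `(T ^ q - T) ^ q = T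
  -- ^ (q ^ 2) - T ^ q`.
  rw [sub_pow_card_of_hom (φ.comp C), ← pow_mul, ← sq, pr, ps]
  linear_combination φ X * h

end FiniteLevel

/-! ### Convergence and nonvanishing in `k_∞` -/

section

variable {F : Type*} [Field F] [Fintype F] [DecidableEq (RatFunc F)]

theorem ofPoly_injective : Function.Injective (ofPoly F) := by
  rw [ofPoly, RingHom.coe_comp]
  exact (ofRat F).injective.comp (RatFunc.algebraMap_injective F)

theorem ofPoly_ne_zero {a : F[X]} (ha : a ≠ 0) : ofPoly F a ≠ 0 :=
  (map_ne_zero_iff _ ofPoly_injective).mpr ha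

theorem tendsto_invPowSum {n : ℕ} (hn : 1 ≤ n) :
    Tendsto (fun d => invPowSum (ofPoly F) d n) atTop (𝓝 (eisenstein (Set.univ : Set F[X]) n)) := by
  classical
  have hs := (summable_inv_pow (F := F) (fun l => l ∈ (Set.univ : Set F[X]) ∧ l ≠ 0)
    (fun _ h => h.2) hn).hasSum
  have hmono : Tendsto (fun d => (nonzeroPolysLT F d).subtype
      fun l => l ∈ (Set.univ : Set F[X]) ∧ l ≠ 0) atTop atTop := by
    refine tendsto_atTop_finset_of_monotone (fun d e hde x hx => ?_) fun x => ?_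
    · rw [Finset.mem_subtype, mem_nonzeroPolysLT] at hx ⊢
      exact ⟨hx.1.trans_le (by exact_mod_cast hde), hx.2⟩
    · refine ⟨(x : F[X]).natDegree + 1, ?_⟩
      rw [Finset.mem_subtype, mem_nonzeroPolysLT]
      exact ⟨Polynomial.degree_le_natDegree.trans_lt (by exact_mod_cast Nat.lt_succ_self _), x.2.2⟩
  refine (hs.comp hmono).congr fun d => ?_
  rw [invPowSum, Function.comp_apply,
    Finset.sum_subtype_of_mem (fun l => (ofPoly F l ^ n)⁻¹)]
  intro l hl
  exact ⟨Set.mem_univ _, (mem_nonzeroPolysLT.mp hl).2⟩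

/-- By the ultrametric inequality, finite partial sums of the tail stay in the open unit ball, which
is also closed and so contains the limit. -/
theorem valued_tsum_sub_sum_lt_one {ι : Type*} {f : ι → KInf F} (hf : Summable f) (s : Finset ι)
    (hs : ∀ i ∉ s, Valued.v (f i) < 1) : Valued.v (∑' i, f i - ∑ i ∈ s, f i) < 1 := by
  classical
  have hcl : IsClosed {x : KInf F | Valued.v x < 1} := by
    have h := Valued.isClosed_ball (KInf F) 1
    simpa using h
  refine hcl.mem_of_tendsto (hf.hasSum.sub_const _) ?_
  filter_upwards [eventually_ge_atTop s] with t ht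
  rw [← Finset.sum_sdiff ht, add_sub_cancel_right]
  refine Valuation.map_sum_lt _ one_ne_zero fun i hi => hs i (Finset.mem_sdiff.mp hi).2

theorem tsum_ne_zero_of_valued {ι : Type*} {f : ι → KInf F} (hf : Summable f) (s : Finset ι)
    (hs : ∀ i ∉ s, Valued.v (f i) < 1) (h1 : Valued.v (∑ i ∈ s, f i) = 1) : ∑' i, f i ≠ 0 := by
  intro h
  have := valued_tsum_sub_sum_lt_one hf s hs
  rw [h, zero_sub, Valuation.map_neg, h1] at this
  exact lt_irrefl _ this

theorem valued_inv_pow_lt_one {a : F[X]} (ha : a.natDegree ≠ 0) {n : ℕ} (hn : 1 ≤ n) :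
    Valued.v ((ofPoly F a ^ n)⁻¹) < 1 := by
  have h0 : a ≠ 0 := by rintro rfl; simp at ha
  rw [map_inv₀, map_pow, valued_ofPoly h0, ← WithZero.exp_nsmul, ← WithZero.exp_neg,
    ← WithZero.exp_zero, WithZero.exp_lt_exp, nsmul_eq_mul, neg_lt_zero]
  have : 0 < a.natDegree := Nat.pos_of_ne_zero ha
  positivity

theorem zetaA_ne_zero {n : ℕ} (hn : 1 ≤ n) : zetaA F n ≠ 0 := by
  refine tsum_ne_zero_of_valued
    (summable_inv_pow (fun l => l ∈ (Set.univ : Set F[X]) ∧ l.Monic) (fun _ h => h.2.ne_zero) hn)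
    {⟨1, Set.mem_univ _, Polynomial.monic_one⟩} (fun i hi => valued_inv_pow_lt_one ?_ hn) ?_
  · contrapose! hi
    rw [Finset.mem_singleton]
    exact Subtype.ext (i.2.2.natDegree_eq_zero.mp hi)
  · simp

/-- Each nonzero constant contributes `c ^ (1 - q) = 1`, so the constants sum to `q - 1 = -1` in
characteristic `p`, a unit; terms of positive degree have absolute value less than `1`. -/
theorem eisenstein_univ_ne_zero :
    eisenstein (Set.univ : Set F[X]) (Fintype.card F - 1) ≠ 0 := by
  classical
  have hq := Fintype.one_lt_card (α := F)
  have hn : 1 ≤ Fintype.card F - 1 := by omega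
  refine tsum_ne_zero_of_valued
    (summable_inv_pow (fun l => l ∈ (Set.univ : Set F[X]) ∧ l ≠ 0) (fun _ h => h.2) hn)
    ((Finset.univ : Finset Fˣ).image fun c : Fˣ => ⟨Polynomial.C (c : F), Set.mem_univ _,
      Polynomial.C_ne_zero.mpr c.ne_zero⟩) (fun i hi => valued_inv_pow_lt_one ?_ hn) ?_
  · contrapose! hi
    obtain ⟨c, hc⟩ := Polynomial.natDegree_eq_zero.mp hi
    have hc0 : c ≠ 0 := fun h => i.2.2 (by rw [← hc, h, Polynomial.C_0])
    exact Finset.mem_image.mpr ⟨Units.mk0 c hc0, Finset.mem_univ _, Subtype.ext hc⟩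
  · rw [Finset.sum_image fun c _ d _ h =>
      Units.ext (Polynomial.C_injective (congrArg Subtype.val h))]
    have : ∀ c : Fˣ, (ofPoly F (Polynomial.C (c : F)) ^ (Fintype.card F - 1))⁻¹ = 1 := fun c => by
      rw [← map_pow, ← map_pow, FiniteField.pow_card_sub_one_eq_one _ c.ne_zero, map_one, map_one,
        inv_one]
    simp only [this]
    rw [Finset.sum_const, Finset.card_univ, Fintype.card_units, nsmul_eq_mul, mul_one,
      Nat.cast_sub (by omega), cast_card_eq_zero_of_hom ((ofPoly F).comp Polynomial.C),
      Nat.cast_one, zero_sub, Valuation.map_neg, map_one]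

theorem carlitz_relation :
    (T F ^ Fintype.card F ^ 2 - T F) *
        eisenstein (Set.univ : Set F[X]) (Fintype.card F ^ 2 - 1) +
      (T F ^ Fintype.card F - T F) ^ Fintype.card F *
        eisenstein (Set.univ : Set F[X]) (Fintype.card F - 1) ^ (Fintype.card F + 1) = 0 := by
  have hq := Fintype.one_lt_card (α := F)
  have hq2 := Nat.one_lt_pow two_ne_zero hq
  exact carlitz_relation_of_tendsto ofPoly_injective (tendsto_invPowSum (by omega))
    (tendsto_invPowSum (by omega))

/-! ### Homogeneity under scaling of the lattice -/

/-- Multiplication by `h` is a bijection from `A` onto `h A`. The predicate `Q` covers both nonzero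
and monic summation; the latter requires `h` monic. -/
theorem tsum_span {h : F[X]} (h0 : h ≠ 0) (Q : F[X] → Prop) (hQ : ∀ a, Q (h * a) ↔ Q a) (n : ℕ) :
    ∑' l : {l : F[X] // l ∈ ((Ideal.span {h} : Ideal F[X]) : Set F[X]) ∧ Q l},
        (ofPoly F (l : F[X]) ^ n)⁻¹ =
      (ofPoly F h ^ n)⁻¹ *
        ∑' l : {l : F[X] // l ∈ (Set.univ : Set F[X]) ∧ Q l}, (ofPoly F (l : F[X]) ^ n)⁻¹ := by
  let g : {l : F[X] // l ∈ (Set.univ : Set F[X]) ∧ Q l} →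
      {l : F[X] // l ∈ ((Ideal.span {h} : Ideal F[X]) : Set F[X]) ∧ Q l} := fun a =>
    ⟨h * a, Ideal.mul_mem_right _ _ (Ideal.mem_span_singleton_self h), (hQ a).mpr a.2.2⟩
  have hg : Function.Bijective g := by
    constructor
    · intro a b hab
      exact Subtype.ext (mul_left_cancel₀ h0 (congrArg Subtype.val hab))
    · rintro ⟨l, hl, hl'⟩
      obtain ⟨a, rfl⟩ := Ideal.mem_span_singleton.mp hl
      exact ⟨⟨a, Set.mem_univ _, (hQ a).mp hl'⟩, rfl⟩
  rw [← (Equiv.ofBijective g hg).tsum_eq, ← tsum_mul_left]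
  refine tsum_congr fun a => ?_
  simp only [Equiv.ofBijective_apply, g, map_mul, mul_pow, mul_inv]

theorem eisenstein_span {h : F[X]} (h0 : h ≠ 0) (n : ℕ) :
    eisenstein ((Ideal.span {h} : Ideal F[X]) : Set F[X]) n =
      (ofPoly F h ^ n)⁻¹ * eisenstein (Set.univ : Set F[X]) n :=
  tsum_span h0 (fun l => l ≠ 0) (fun a => by simp [h0]) n

theorem monicZeta_span {h : F[X]} (hh : h.Monic) (n : ℕ) :
    monicZeta ((Ideal.span {h} : Ideal F[X]) : Set F[X]) n =
      (ofPoly F h ^ n)⁻¹ * zetaA F n :=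
  tsum_span hh.ne_zero (fun l => l.Monic) (fun _ => ⟨hh.of_mul_monic_left, hh.mul⟩) n

/-! ### Approximations of a rational `f` -/

theorem absInf_mul (x y : KInf F) : absInf (x * y) = absInf x * absInf y := by
  simp only [absInf, map_mul, NNReal.coe_mul]

theorem absInf_zero : absInf (0 : KInf F) = 0 := by
  simp only [absInf, map_zero, NNReal.coe_zero]

theorem one_le_absInf_ofPoly {a : F[X]} (ha : a ≠ 0) : 1 ≤ absInf (ofPoly F a) := by
  rw [absInf_ofPoly ha]
  exact one_le_pow₀ (by exact_mod_cast Fintype.card_pos)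

theorem ofPoly_denom_mul (f : RatFunc F) :
    ofPoly F f.denom * ofRat F f = ofPoly F f.num := by
  simp only [ofPoly, RingHom.comp_apply]
  rw [← map_mul]
  congr 1
  rw [mul_comm, ← eq_div_iff (RatFunc.algebraMap_ne_zero f.denom_ne_zero), f.num_div_denom]

theorem distA_nonneg (x : KInf F) : 0 ≤ distA x := Real.iInf_nonneg fun _ => NNReal.coe_nonneg _

theorem distA_ofPoly (a : F[X]) : distA (ofPoly F a) = 0 := by
  refine le_antisymm ((isLeast_distA _).2 ⟨a, ?_⟩) (distA_nonneg _)
  simp only [sub_self, absInf_zero]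

theorem epsApprox_ofRat (f : RatFunc F) {ε : ℝ} (hε : 0 < ε)
    (hlt : ε < (absInf (ofPoly F f.denom))⁻¹) :
    epsApprox (ofRat F f) ε = (Ideal.span {f.denom} : Ideal F[X]) := by
  ext l
  rw [SetLike.mem_coe, Ideal.mem_span_singleton]
  change distA _ < ε ↔ _
  have hpos : 0 < absInf (ofPoly F f.denom) :=
    one_pos.trans_le (one_le_absInf_ofPoly f.denom_ne_zero)
  constructor
  · intro hl
    obtain ⟨a, ha⟩ := (isLeast_distA (ofPoly F l * ofRat F f)).1
    simp only at ha
    rw [← ha] at hl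
    have h1 : ofPoly F (l * f.num - a * f.denom) =
        ofPoly F f.denom * (ofPoly F l * ofRat F f - ofPoly F a) := by
      rw [map_sub, map_mul, map_mul, ← ofPoly_denom_mul]
      ring
    -- A nonzero polynomial has absolute value at least `1`, whereas the bound on `ε` makes this one
    -- smaller than `1`.
    have h2 : l * f.num - a * f.denom = 0 := by
      by_contra h0
      have h3 := one_le_absInf_ofPoly h0
      rw [h1, absInf_mul] at h3
      have h4 := mul_lt_mul_of_pos_left (hl.trans hlt) hpos
      rw [mul_inv_cancel₀ hpos.ne'] at h4
      linarith
    exact f.isCoprime_num_denom.symm.dvd_of_dvd_mul_right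
      (Dvd.intro_left a (sub_eq_zero.mp h2).symm)
  · rintro ⟨a, rfl⟩
    have : ofPoly F (f.denom * a) * ofRat F f = ofPoly F (a * f.num) := by
      rw [map_mul, map_mul, ← ofPoly_denom_mul]
      ring
    rwa [this, distA_ofPoly]

theorem T_pow_card_sub_T_ne_zero : T F ^ Fintype.card F - T F ≠ 0 := by
  rw [T, ← map_pow, ← map_sub]
  exact ofPoly_ne_zero (FiniteField.X_pow_card_sub_X_ne_zero F Fintype.one_lt_card)

theorem card_sq_sub_one : Fintype.card F ^ 2 - 1 = (Fintype.card F - 1) * (Fintype.card F + 1) := by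
  rw [mul_comm, ← Nat.sq_sub_sq, one_pow]

/-- Since `q ^ 2 - 1 = (q - 1) (q + 1)`, both terms of `Δ_ε` scale by the same power of the
denominator, and `Δ_ε` is a multiple of the Carlitz relation. -/
theorem jEps_ofRat (f : RatFunc F) {ε : ℝ} (hε : 0 < ε)
    (hlt : ε < (absInf (ofPoly F f.denom))⁻¹) : jEps (ofRat F f) ε = OnePoint.infty := by
  have hD : DeltaEps (ofRat F f) ε = 0 := by
    simp only [DeltaEps]
    rw [epsApprox_ofRat f hε hlt, eisenstein_span f.denom_ne_zero, eisenstein_span f.denom_ne_zero,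
      card_sq_sub_one, pow_mul, mul_pow, inv_pow]
    have h := carlitz_relation (F := F)
    rw [card_sq_sub_one] at h
    linear_combination (((ofPoly F f.denom ^ (Fintype.card F - 1)) ^ (Fintype.card F + 1))⁻¹) * h
  rw [jEps, quot, if_pos hD]

end

end QuantumJ

/-! ### The main theorem -/

theorem mainTheorem3 {F : Type*} [Field F] [Fintype F] [DecidableEq (RatFunc F)]
    (f : RatFunc F) :
    (∃ ε₀ : ℝ, 0 < ε₀ ∧ ∀ ε : ℝ, 0 < ε → ε < ε₀ →
      (∃ h : Polynomial F, h ≠ 0 ∧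
        QuantumJ.epsApprox (QuantumJ.ofRat F f) ε = (Ideal.span {h} : Ideal (Polynomial F))) ∧
      QuantumJ.epsZeta (QuantumJ.ofRat F f) ε (Fintype.card F - 1) ≠ 0 ∧
      QuantumJ.zetaA F (Fintype.card F - 1) ≠ 0 ∧
      QuantumJ.epsZeta (QuantumJ.ofRat F f) ε (Fintype.card F ^ 2 - 1) /
          QuantumJ.epsZeta (QuantumJ.ofRat F f) ε (Fintype.card F - 1) ^ (Fintype.card F + 1) =
        QuantumJ.zetaA F (Fintype.card F ^ 2 - 1) /
          QuantumJ.zetaA F (Fintype.card F - 1) ^ (Fintype.card F + 1) ∧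
      QuantumJ.gEps (QuantumJ.ofRat F f) ε ≠ 0 ∧
      QuantumJ.jEps (QuantumJ.ofRat F f) ε = OnePoint.infty) ∧
    QuantumJ.jqt (QuantumJ.ofRat F f) = {OnePoint.infty} := by
  open QuantumJ in
  have hq := Fintype.one_lt_card (α := F)
  have hd : ofPoly F f.denom ≠ 0 := ofPoly_ne_zero f.denom_ne_zero
  have hζ : zetaA F (Fintype.card F - 1) ≠ 0 := zetaA_ne_zero (by omega)
  have hpos : 0 < (absInf (ofPoly F f.denom))⁻¹ :=
    inv_pos.mpr (one_pos.trans_le (one_le_absInf_ofPoly f.denom_ne_zero))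
  have hj : ∀ ε : ℕ → ℝ, (∀ i, 0 < ε i) → Tendsto ε atTop (𝓝 0) →
      Tendsto (fun i => jEps (ofRat F f) (ε i)) atTop (𝓝 OnePoint.infty) := fun ε h0 hε =>
    tendsto_const_nhds.congr' ((hε.eventually_lt_const hpos).mono fun i hi =>
      (jEps_ofRat f (h0 i) hi).symm)
  refine ⟨⟨_, hpos, fun ε hε hlt => ?_⟩, ?_⟩
  · have hΛ := epsApprox_ofRat f hε hlt
    refine ⟨⟨f.denom, f.denom_ne_zero, hΛ⟩, ?_, hζ, ?_, ?_, jEps_ofRat f hε hlt⟩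
    · rw [epsZeta, hΛ, monicZeta_span f.monic_denom]
      exact mul_ne_zero (inv_ne_zero (pow_ne_zero _ hd)) hζ
    · rw [epsZeta, epsZeta, hΛ, monicZeta_span f.monic_denom, monicZeta_span f.monic_denom,
        card_sq_sub_one, pow_mul, mul_pow, inv_pow]
      exact mul_div_mul_left _ _ (inv_ne_zero (pow_ne_zero _ (pow_ne_zero _ hd)))
    · simp only [gEps]
      rw [hΛ, eisenstein_span f.denom_ne_zero]
      exact mul_ne_zero T_pow_card_sub_T_ne_zero
        (mul_ne_zero (inv_ne_zero (pow_ne_zero _ hd)) eisenstein_univ_ne_zero)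
  · refine Set.eq_singleton_iff_unique_mem.mpr ⟨?_, ?_⟩
    · exact ⟨fun i => 1 / ((i : ℝ) + 1), fun i => Nat.one_div_pos_of_nat,
        tendsto_one_div_add_atTop_nhds_zero_nat,
        hj _ (fun i => Nat.one_div_pos_of_nat) tendsto_one_div_add_atTop_nhds_zero_nat⟩
    -- Along any admissible sequence `j_ε` is eventually the constant `∞`, which leaves no other
    -- limit.
    · rintro x ⟨ε, h0, hε, hx⟩
      have hc : Tendsto (fun _ : ℕ => (OnePoint.infty : OnePoint (KInf F))) atTop (𝓝 x) :=
        hx.congr' ((hε.eventually_lt_const hpos).mono fun i hi => jEps_ofRat f (h0 i) hi)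
      exact (tendsto_const_nhds_iff.mp hc).symm
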